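/- Let $G$ be an ample groupoid, that is, a topological groupoid whose topology has a basis of compact open bisections (an open bisection is an open set $B\subseteq G$ on which the source map $s$ and the range map $r$ restrict to homeomorphisms onto open subsets of the unit space $G^{(0)}$). Suppose that $G^{(0)}$ is Hausdorff ($G$ itself need not be). Let $\Gamma$ be a discrete group and let $c:G\to\Gamma$ be a continuous cocycle, i.e. $c(xy)=c(x)c(y)$ whenever $s(x)=r(y)$. Let $C(G)$ be the linear span of the functions $f:G\to\mathbb{C}$ for which there is an open bisection $U$ such that $f$ is continuous on $U$ and vanishes outside a compact subset of $U$. The reduced $C^*$-algebra $C^*_r(G)$ is the $C^*$-algebra of operators on $\ell^2(G)=\bigoplus_{u\in G^{(0)}}\ell^2(s^{-1}(u))$ generated by the operators $\lambda(f)$, $f\in C(G)$, where $\lambda$ is the (injective) regular representation \[(\lambda(f)\xi)(x)=\sum_{s(z)=s(x)}f(xz^{-1})\,\xi(z)\] (equivalently, it is the completion of the convolution $*$-algebra $C(G)$ in the norm $\|f\|_r=\|\lambda(f)\|$). Let \[A(G)=\operatorname{span}\{1_B: B\subseteq G \text{ a compact open bisection}\}\subseteq C(G)\] be the complex Steinberg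 algebra, regarded as a subspace of $C^*_r(G)$ via $\lambda$, and for $\gamma\in\Gamma$ put \[A(G)_\gamma=\{f\in A(G): \operatorname{supp} f\subseteq c^{-1}(\gamma)\},\qquad C^*_r(G)_\gamma=\overline{A(G)_\gamma}\subseteq C^*_r(G).\] Then $C^*_r(G)$ is a $\Gamma$-graded $C^*$-algebra with homogeneous subspaces $C^*_r(G)_\gamma$. That is, the $C^*_r(G)_\gamma$ $(\gamma\in\Gamma)$ are linearly independent closed linear subspaces of $C^*_r(G)$ such that for all $\alpha,\beta\in\Gamma$: 1. $\operatorname{span}\{ab: a\in C^*_r(G)_\alpha,\ b\in C^*_r(G)_\beta\}\subseteq C^*_r(G)_{\alpha\beta}$; 2. $\{a^*: a\in C^*_r(G)_\alpha\}\subseteq C^*_r(G)_{\alpha^{-1}}$; 3. $\bigoplus_{\gamma\in\Gamma}C^*_r(G)_\gamma$ is dense in $C^*_r(G)$. -/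

import Mathlib

open scoped ENNReal

noncomputable section

/-- A topological groupoid, presented by its space of arrows `G`.  Units are identified with
identity arrows, `src` and `rng` are the source and range maps, and the product `x * y` is the
groupoid product whenever `src x = rng y`.  The values of `x * y` on non-composable pairs are
irrelevant: no axiom and no later definition uses them. -/
class TopologicalGroupoid (G : Type*) [TopologicalSpace G] extends Mul G, Inv G where
  src : G → G
  rng : G → G
  src_src : ∀ x, src (src x) = src x
  rng_src : ∀ x, rng (src x) = src x
  src_rng : ∀ x, src (rng x) = rng x
  rng_rng : ∀ x, rng (rng x) = rng x
  src_mul : ∀ x y, src x = rng y → src (x * y) = src y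
  rng_mul : ∀ x y, src x = rng y → rng (x * y) = rng x
  mul_assoc : ∀ x y z, src x = rng y → src y = rng z → (x * y) * z = x * (y * z)
  mul_src : ∀ x, x * src x = x
  rng_mul_self : ∀ x, rng x * x = x
  src_inv : ∀ x, src x⁻¹ = rng x
  rng_inv : ∀ x, rng x⁻¹ = src x
  inv_mul : ∀ x, x⁻¹ * x = src x
  mul_inv : ∀ x, x * x⁻¹ = rng x
  continuous_inv : Continuous (fun x : G => x⁻¹)
  continuousOn_mul : ContinuousOn (fun p : G × G => p.1 * p.2) {p | src p.1 = rng p.2}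

namespace TopologicalGroupoid

variable (G : Type*) [TopologicalSpace G] [TopologicalGroupoid G]

/-- The unit space `G⁽⁰⁾`, with the subspace topology. -/
abbrev UnitSpace : Type _ := {x : G // src x = x}

variable {G}

/-- The source map as a map into the unit space. -/
def srcUnit (x : G) : UnitSpace G := ⟨src x, src_src x⟩

/-- The range map as a map into the unit space. -/
def rngUnit (x : G) : UnitSpace G := ⟨rng x, src_rng x⟩

/-- An open bisection: an open set on which the source and the range map are homeomorphisms onto
open subsets of the unit space. -/
structure IsOpenBisection (B : Set G) : Prop where
  isOpen : IsOpen B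
  src_emb : Topology.IsOpenEmbedding (fun x : B => srcUnit (x : G))
  rng_emb : Topology.IsOpenEmbedding (fun x : B => rngUnit (x : G))

variable (G) in
/-- An ample groupoid: the compact open bisections form a basis of the topology. -/
class IsAmple : Prop where
  isTopologicalBasis :
    TopologicalSpace.IsTopologicalBasis {B : Set G | IsOpenBisection B ∧ IsCompact B}

/-- A (one-)cocycle, that is, a groupoid homomorphism into a group. -/
def IsCocycle {Γ : Type*} [Group Γ] (c : G → Γ) : Prop :=
  ∀ x y : G, src x = rng y → c (x * y) = c x * c y

/-! ### Function spaces on the groupoid -/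

variable (G) in
/-- The space `C(G)` of a (not necessarily Hausdorff) étale groupoid: the span of the functions
that, for some open bisection `U`, are continuous on `U` and vanish outside a compact subset
of `U`. -/
def compactlySupported : Submodule ℂ (G → ℂ) :=
  Submodule.span ℂ {f | ∃ U : Set G, IsOpenBisection U ∧ ContinuousOn f U ∧
    ∃ K ⊆ U, IsCompact K ∧ Function.support f ⊆ K}

variable (G) in
/-- The (underlying vector space of the) complex Steinberg algebra `A(G)`: the span of the
characteristic functions of compact open bisections. -/
def steinbergAlgebra : Submodule ℂ (G → ℂ) :=
  Submodule.span ℂ {f | ∃ B : Set G, IsOpenBisection B ∧ IsCompact B ∧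
    f = Set.indicator B (fun _ => 1)}

variable (G) in
theorem steinbergAlgebra_le : steinbergAlgebra G ≤ compactlySupported G := by
  refine Submodule.span_mono ?_
  rintro f ⟨B, hB, hK, rfl⟩
  refine ⟨B, hB, ?_, B, subset_rfl, hK, Set.support_indicator_subset⟩
  exact continuousOn_const.congr fun x hx => Set.indicator_of_mem hx _

/-- The homogeneous piece `A(G)_γ = {f ∈ A(G) : supp f ⊆ c⁻¹(γ)}` of the Steinberg algebra. -/
def steinbergPiece {Γ : Type*} (c : G → Γ) (γ : Γ) : Submodule ℂ (steinbergAlgebra G) where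
  carrier := {f | Function.support (f : G → ℂ) ⊆ c ⁻¹' {γ}}
  zero_mem' := by simp
  add_mem' := by
    intro f g hf hg x hx
    by_contra h
    have h1 : (f : G → ℂ) x = 0 := by
      by_contra h2
      exact h (hf h2)
    have h3 : (g : G → ℂ) x = 0 := by
      by_contra h2
      exact h (hg h2)
    simp [h1, h3] at hx
  smul_mem' := by
    intro a f hf x hx
    refine hf ?_
    intro h
    simp [h] at hx

/-! ### The regular representation -/

variable (G) in
/-- The Hilbert space `ℓ²(G)`, which is the Hilbert sum over the units `u` of the spaces
`ℓ²(src⁻¹(u))`. -/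
abbrev L2 : Type _ := lp (fun _ : G => ℂ) 2

open scoped Classical in
/-- The matrix of the regular representation of `f`. -/
def kernel (f : G → ℂ) (x z : G) : ℂ := if src x = src z then f (x * z⁻¹) else 0

/-- `IsBoundedKernel k` is the condition of the Schur test. -/
def IsBoundedKernel {ι : Type*} (k : ι → ι → ℂ) : Prop :=
  ∃ C : NNReal, (∀ x, ∑' z, ‖k x z‖ₑ ≤ C) ∧ (∀ z, ∑' x, ‖k x z‖ₑ ≤ C)

theorem schur_pointwise {ι : Type*} (w f : ι → ℝ≥0∞) :
    (∑' i, w i * f i) ^ 2 ≤ (∑' i, w i) * ∑' i, w i * f i ^ 2 := by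
  rw [ENNReal.tsum_eq_iSup_sum, ENNReal.iSup_pow]
  refine iSup_le fun s => ?_
  have h := ENNReal.inner_le_weight_mul_Lp_of_nonneg s (p := 2) (by norm_num) w f
  calc (∑ i ∈ s, w i * f i) ^ 2
      ≤ ((∑ i ∈ s, w i) ^ (1 - (2 : ℝ)⁻¹) * (∑ i ∈ s, w i * f i ^ (2 : ℝ)) ^ (2 : ℝ)⁻¹) ^ 2 := by
        gcongr
    _ = (∑ i ∈ s, w i) * ∑ i ∈ s, w i * f i ^ 2 := by
        rw [mul_pow, ← ENNReal.rpow_natCast, ← ENNReal.rpow_natCast, ← ENNReal.rpow_mul,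
          ← ENNReal.rpow_mul]
        norm_num
    _ ≤ _ := by
        gcongr <;> exact ENNReal.sum_le_tsum s

theorem schur_bound {ι : Type*} (k : ι → ι → ℂ) (C : NNReal) (h1 : ∀ x, ∑' z, ‖k x z‖ₑ ≤ C)
    (h2 : ∀ z, ∑' x, ‖k x z‖ₑ ≤ C) (ξ : ι → ℂ) :
    ∑' x, ‖∑' z, k x z * ξ z‖ₑ ^ 2 ≤ (C : ℝ≥0∞) ^ 2 * ∑' z, ‖ξ z‖ₑ ^ 2 := by
  calc ∑' x, ‖∑' z, k x z * ξ z‖ₑ ^ 2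
      ≤ ∑' x, (∑' z, ‖k x z‖ₑ * ‖ξ z‖ₑ) ^ 2 := by
        refine ENNReal.tsum_le_tsum fun x => ?_
        gcongr
        refine (enorm_tsum_le_tsum_enorm).trans ?_
        simp [enorm_mul]
    _ ≤ ∑' x, (C : ℝ≥0∞) * ∑' z, ‖k x z‖ₑ * ‖ξ z‖ₑ ^ 2 := by
        refine ENNReal.tsum_le_tsum fun x => (schur_pointwise _ _).trans ?_
        gcongr
        exact h1 x
    _ = (C : ℝ≥0∞) * ∑' z, (∑' x, ‖k x z‖ₑ) * ‖ξ z‖ₑ ^ 2 := by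
        rw [ENNReal.tsum_mul_left, ENNReal.tsum_comm]
        simp_rw [ENNReal.tsum_mul_right]
    _ ≤ (C : ℝ≥0∞) * ∑' z, (C : ℝ≥0∞) * ‖ξ z‖ₑ ^ 2 := by
        gcongr with z
        exact h2 z
    _ = _ := by
        rw [ENNReal.tsum_mul_left, ← _root_.mul_assoc, sq (C : ℝ≥0∞)]

theorem l2_enorm_sq {ι : Type*} (ξ : lp (fun _ : ι => ℂ) 2) :
    ∑' z, ‖ξ z‖ₑ ^ 2 = ENNReal.ofReal (‖ξ‖ ^ 2) := by
  have h := lp.hasSum_norm (p := 2) (by norm_num) ξ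
  norm_num at h
  rw [← h.tsum_eq, ENNReal.ofReal_tsum_of_nonneg (fun _ => by positivity) h.summable]
  refine tsum_congr fun z => ?_
  rw [ENNReal.ofReal_pow (norm_nonneg _), ofReal_norm]

theorem l2_mem {ι : Type*} (η : ι → ℂ) (h : ∑' z, ‖η z‖ₑ ^ 2 ≠ ∞) :
    Memℓp (E := fun _ : ι => ℂ) η 2 := by
  rw [memℓp_gen_iff (by norm_num)]
  have := ENNReal.summable_toReal h
  simpa using this

/-- A kernel satisfying the condition of the Schur test has absolutely convergent rows. -/
theorem IsBoundedKernel.summable {ι : Type*} {k : ι → ι → ℂ} (hk : IsBoundedKernel k)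
    (ξ : lp (fun _ : ι => ℂ) 2) (x : ι) : Summable fun z => k x z * ξ z := by
  obtain ⟨C, h1, -⟩ := hk
  have hs : Summable fun z => ‖k x z‖ := by
    have := ENNReal.summable_toReal (ne_top_of_le_ne_top ENNReal.coe_ne_top (h1 x))
    simpa using this
  refine Summable.of_norm_bounded (hs.mul_right ‖ξ‖) fun z => ?_
  rw [norm_mul]
  gcongr
  exact lp.norm_apply_le_norm (by norm_num) ξ z

/-- The bounded operator on `ℓ²` with matrix `k`: `(T ξ)(x) = ∑ k(x, z) ξ(z)`. -/
def kernelOperator {ι : Type*} (k : ι → ι → ℂ) (hk : IsBoundedKernel k) :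
    lp (fun _ : ι => ℂ) 2 →L[ℂ] lp (fun _ : ι => ℂ) 2 :=
  LinearMap.mkContinuousOfExistsBound
    { toFun := fun ξ => ⟨fun x => ∑' z, k x z * ξ z, by
        obtain ⟨C, h1, h2⟩ := hk
        refine l2_mem _ (ne_top_of_le_ne_top ?_ (schur_bound k C h1 h2 ξ))
        rw [l2_enorm_sq]
        exact ENNReal.mul_ne_top (by simp) ENNReal.ofReal_ne_top⟩
      map_add' := fun ξ η => by
        ext x
        simp only [lp.coeFn_add, Pi.add_apply, mul_add]
        exact (hk.summable ξ x).tsum_add (hk.summable η x)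
      map_smul' := fun a ξ => by
        ext x
        simp only [lp.coeFn_smul, Pi.smul_apply, smul_eq_mul, RingHom.id_apply]
        rw [← tsum_mul_left]
        exact tsum_congr fun z => by ring }
    (by
      obtain ⟨C, h1, h2⟩ := id hk
      refine ⟨C, fun ξ => ?_⟩
      refine (sq_le_sq₀ (norm_nonneg _) (by positivity)).1 ?_
      have hC : (C : ℝ≥0∞) ^ 2 * ENNReal.ofReal (‖ξ‖ ^ 2) = ENNReal.ofReal ((C * ‖ξ‖) ^ 2) := by
        rw [mul_pow, ENNReal.ofReal_mul (by positivity), ENNReal.ofReal_pow (NNReal.coe_nonneg C),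
          ENNReal.ofReal_coe_nnreal]
      have h := schur_bound k C h1 h2 ξ
      rw [l2_enorm_sq, hC] at h
      exact (ENNReal.ofReal_le_ofReal_iff (by positivity)).1 ((l2_enorm_sq _).ge.trans h))

theorem kernelOperator_apply {ι : Type*} (k : ι → ι → ℂ) (hk : IsBoundedKernel k)
    (ξ : lp (fun _ : ι => ℂ) 2) (x : ι) :
    (kernelOperator k hk ξ : ι → ℂ) x = ∑' z, k x z * ξ z := rfl

theorem mul_inv_cancel_right' {x y z : G} (hx : src x = src z) (hy : src y = src z)
    (h : x * z⁻¹ = y * z⁻¹) : x = y := by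
  have key : ∀ w : G, src w = src z → (w * z⁻¹) * z = w := fun w hw => by
    rw [TopologicalGroupoid.mul_assoc _ _ _ (by rw [rng_inv, hw]) (by rw [src_inv]),
      inv_mul, ← hw, mul_src]
  rw [← key x hx, h, key y hy]

theorem inv_inv' (x : G) : x⁻¹⁻¹ = x := by
  have h : x⁻¹⁻¹ = x⁻¹⁻¹ * (x⁻¹ * x) := by
    have := mul_src (x⁻¹⁻¹)
    rw [src_inv, rng_inv] at this
    rw [inv_mul, this]
  rw [h, ← TopologicalGroupoid.mul_assoc _ _ _ (by rw [src_inv]) (by rw [src_inv]), inv_mul,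
    src_inv, rng_mul_self]

theorem mul_inv_cancel_left' {x y z : G} (hy : src x = src y) (hz : src x = src z)
    (h : x * y⁻¹ = x * z⁻¹) : y = z := by
  have key : ∀ w : G, src x = src w → x⁻¹ * (x * w⁻¹) = w⁻¹ := fun w hw => by
    rw [← TopologicalGroupoid.mul_assoc _ _ _ (by rw [src_inv]) (by rw [rng_inv, hw]), inv_mul,
      hw, ← rng_inv, rng_mul_self]
  rw [← inv_inv' y, ← key y hy, h, key z hz, inv_inv']

theorem isBoundedKernel_add {ι : Type*} {k l : ι → ι → ℂ} (hk : IsBoundedKernel k)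
    (hl : IsBoundedKernel l) : IsBoundedKernel (fun x z => k x z + l x z) := by
  obtain ⟨C, h1, h2⟩ := hk
  obtain ⟨D, h3, h4⟩ := hl
  refine ⟨C + D, fun x => ?_, fun z => ?_⟩
  · refine (ENNReal.tsum_le_tsum fun z => enorm_add_le _ _).trans ?_
    rw [ENNReal.tsum_add, ENNReal.coe_add]
    exact add_le_add (h1 x) (h3 x)
  · refine (ENNReal.tsum_le_tsum fun x => enorm_add_le _ _).trans ?_
    rw [ENNReal.tsum_add, ENNReal.coe_add]
    exact add_le_add (h2 z) (h4 z)

theorem isBoundedKernel_smul {ι : Type*} {k : ι → ι → ℂ} (a : ℂ) (hk : IsBoundedKernel k) :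
    IsBoundedKernel (fun x z => a * k x z) := by
  obtain ⟨C, h1, h2⟩ := hk
  refine ⟨‖a‖₊ * C, fun x => ?_, fun z => ?_⟩
  · simp only [enorm_mul, ENNReal.tsum_mul_left, ENNReal.coe_mul, enorm_eq_nnnorm a]
    gcongr
    exact h1 x
  · simp only [enorm_mul, ENNReal.tsum_mul_left, ENNReal.coe_mul, enorm_eq_nnnorm a]
    gcongr
    exact h2 z

theorem kernel_add (f g : G → ℂ) (x z : G) : kernel (f + g) x z = kernel f x z + kernel g x z := by
  unfold kernel
  split_ifs <;> simp

theorem kernel_smul (a : ℂ) (f : G → ℂ) (x z : G) : kernel (a • f) x z = a * kernel f x z := by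
  unfold kernel
  split_ifs <;> simp

theorem tsum_le_of_subsingleton_support {ι : Type*} (w : ι → ℝ≥0∞) (C : ℝ≥0∞)
    (hC : ∀ i, w i ≤ C) (hw : ∀ i j, w i ≠ 0 → w j ≠ 0 → i = j) : ∑' i, w i ≤ C := by
  by_cases h : ∃ i, w i ≠ 0
  · obtain ⟨i, hi⟩ := h
    rw [tsum_eq_single i fun j hj => by
      by_contra h'
      exact hj (hw j i h' hi)]
    exact hC i
  · push Not at h
    simp [h]

theorem isBoundedKernel_of_mem {f : G → ℂ} (hf : f ∈ compactlySupported G) :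
    IsBoundedKernel (kernel f) := by
  induction hf using Submodule.span_induction with
  | zero => exact ⟨0, by simp [kernel], by simp [kernel]⟩
  | add f g _ _ hf hg => simpa only [← kernel_add] using isBoundedKernel_add hf hg
  | smul a f _ hf => simpa only [← kernel_smul] using isBoundedKernel_smul a hf
  | mem f hf =>
    obtain ⟨U, hU, hc, K, hKU, hK, hs⟩ := hf
    obtain ⟨M, hM⟩ := hK.exists_bound_of_continuousOn (hc.mono hKU)
    have hb : ∀ x, ‖f x‖ ≤ max M 0 := fun x => by
      by_cases hx : x ∈ K
      · exact (hM x hx).trans (le_max_left _ _)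
      · have : f x = 0 := by
          by_contra h
          exact hx (hs h)
        simp [this]
    have hke : ∀ x z, ‖kernel f x z‖ₑ ≤ ((max M 0).toNNReal : ℝ≥0∞) := fun x z => by
      unfold kernel
      split_ifs
      · rw [← ofReal_norm]
        exact ENNReal.ofReal_le_ofReal (hb _)
      · simp
    have hne : ∀ x z, ‖kernel f x z‖ₑ ≠ 0 → src x = src z ∧ x * z⁻¹ ∈ U := fun x z h => by
      unfold kernel at h
      split_ifs at h with h1
      · exact ⟨h1, hKU (hs (by simpa using h))⟩
      · simp at h
    refine ⟨(max M 0).toNNReal, fun x => ?_, fun z => ?_⟩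
    · refine tsum_le_of_subsingleton_support _ _ (hke x) fun y z hy hz => ?_
      obtain ⟨hy1, hy2⟩ := hne _ _ hy
      obtain ⟨hz1, hz2⟩ := hne _ _ hz
      refine mul_inv_cancel_left' hy1 hz1 ?_
      have := @hU.rng_emb.injective ⟨_, hy2⟩ ⟨_, hz2⟩ (Subtype.ext (by
        simp only [rngUnit]
        rw [rng_mul _ _ (by rw [rng_inv, hy1]), rng_mul _ _ (by rw [rng_inv, hz1])]))
      exact congrArg Subtype.val this
    · refine tsum_le_of_subsingleton_support _ _ (fun x => hke x z) fun x y hx hy => ?_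
      obtain ⟨hx1, hx2⟩ := hne _ _ hx
      obtain ⟨hy1, hy2⟩ := hne _ _ hy
      refine mul_inv_cancel_right' hx1 hy1 ?_
      have := @hU.src_emb.injective ⟨_, hx2⟩ ⟨_, hy2⟩ (Subtype.ext (by
        simp only [srcUnit]
        rw [src_mul _ _ (by rw [rng_inv, hx1]), src_mul _ _ (by rw [rng_inv, hy1])]))
      exact congrArg Subtype.val this

variable (G) in
/-- The regular representation of `C(G)` on `ℓ²(G)`, the direct sum over the units `u` of the
regular representations on `ℓ²(src⁻¹(u))`:
`(λ(f) ξ)(x) = ∑ f(x z⁻¹) ξ(z)`, the sum being over all `z` with `src z = src x`.  Thus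
`‖λ(f)‖` is the reduced norm of `f`. -/
def regularRep : compactlySupported G →ₗ[ℂ] (L2 G →L[ℂ] L2 G) where
  toFun f := kernelOperator (kernel (f : G → ℂ)) (isBoundedKernel_of_mem f.2)
  map_add' f g := by
    ext ξ x
    simp only [kernelOperator_apply, _root_.add_apply, lp.coeFn_add, Pi.add_apply,
      Submodule.coe_add, kernel_add, add_mul]
    exact ((isBoundedKernel_of_mem f.2).summable ξ x).tsum_add
      ((isBoundedKernel_of_mem g.2).summable ξ x)
  map_smul' a f := by
    ext ξ x
    simp only [kernelOperator_apply, _root_.smul_apply, lp.coeFn_smul, Pi.smul_apply,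
      Submodule.coe_smul, kernel_smul, smul_eq_mul, RingHom.id_apply, _root_.mul_assoc,
      _root_.tsum_mul_left]

theorem regularRep_apply (f : compactlySupported G) (ξ : L2 G) (x : G) :
    (regularRep G f ξ : G → ℂ) x = ∑' z, kernel (f : G → ℂ) x z * ξ z := rfl

theorem inv_src (x : G) : (src x)⁻¹ = src x := by
  have h := mul_src (src x)⁻¹
  rw [src_inv, rng_src] at h
  rw [← h]
  have h' := inv_mul (src x)
  rwa [src_src] at h'

/-- `C(G)`, and so `A(G)`, embeds into the operators on `ℓ²(G)`. -/
theorem regularRep_injective : Function.Injective (regularRep G) := by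
  classical
  intro f g hfg
  ext x
  have key : ∀ f : compactlySupported G,
      (regularRep G f (lp.single 2 (src x) (1 : ℂ)) : G → ℂ) x = (f : G → ℂ) x := fun f => by
    rw [regularRep_apply, tsum_eq_single (src x)]
    · simp [kernel, src_src, inv_src, mul_src]
    · intro z hz
      simp [lp.single_apply, Pi.single_eq_of_ne hz]
  rw [← key f, hfg, key g]

variable (G) in
/-- The reduced C*-algebra `C*_r(G)`: the C*-algebra of operators on `ℓ²(G)` generated by the image
of `C(G)` under the regular representation.  The image is already a *-algebra for the convolution
product and the involution `f*(x) = conj (f(x⁻¹))`, so this is the completion of `C(G)` in the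
reduced norm. -/
def reducedCStarAlgebra : NonUnitalStarSubalgebra ℂ (L2 G →L[ℂ] L2 G) :=
  (NonUnitalStarAlgebra.adjoin ℂ (Set.range (regularRep G))).topologicalClosure

instance : IsClosed (reducedCStarAlgebra G : Set (L2 G →L[ℂ] L2 G)) :=
  NonUnitalStarSubalgebra.isClosed_topologicalClosure _

variable (G) in
/-- The canonical map `C(G) → C*_r(G)`. -/
def toReduced : compactlySupported G →ₗ[ℂ] reducedCStarAlgebra G :=
  LinearMap.codRestrict (reducedCStarAlgebra G).toNonUnitalSubalgebra.toSubmodule (regularRep G)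
    fun f => NonUnitalStarSubalgebra.le_topologicalClosure _
      (NonUnitalStarAlgebra.subset_adjoin ℂ _ (Set.mem_range_self f))

variable (G) in
/-- The canonical map `A(G) → C*_r(G)`. -/
def steinbergToReduced : steinbergAlgebra G →ₗ[ℂ] reducedCStarAlgebra G :=
  toReduced G ∘ₗ Submodule.inclusion (steinbergAlgebra_le G)

/-- `C*_r(G)_γ`: the closure in `C*_r(G)` of the image of `A(G)_γ`. -/
def reducedPiece {Γ : Type*} (c : G → Γ) (γ : Γ) : Submodule ℂ (reducedCStarAlgebra G) :=
  ((steinbergPiece c γ).map (steinbergToReduced G)).topologicalClosure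

end TopologicalGroupoid

/-- `A` is a `Γ`-graded C*-algebra with homogeneous subspaces `𝒜 γ`. -/
structure IsGradedCStarAlgebra {Γ : Type*} [Group Γ] {A : Type*} [NonUnitalCStarAlgebra A]
    (𝒜 : Γ → Submodule ℂ A) : Prop where
  isClosed : ∀ γ, IsClosed (𝒜 γ : Set A)
  /-- The subspaces are linearly independent. -/
  independent : iSupIndep 𝒜
  mul_mem : ∀ α β : Γ, ∀ a ∈ 𝒜 α, ∀ b ∈ 𝒜 β, a * b ∈ 𝒜 (α * β)
  star_mem : ∀ γ : Γ, ∀ a ∈ 𝒜 γ, star a ∈ 𝒜 γ⁻¹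
  dense : Dense ((⨆ γ, 𝒜 γ : Submodule ℂ A) : Set A)

end

/-! An operator on `ℓ²(G)` is determined by its matrix entries, and each entry is continuous in the
operator. The entry of `λ(f)` at `(x, z)`, where `src x = src z`, is `f (x * z⁻¹)`. So every
operator in the closure of `A(G)_γ` has its matrix supported where `c (x * z⁻¹) = γ`. These regions
are disjoint for different `γ`, which gives independence (`iSupIndep_reducedPiece`).

For products and adjoints, `c⁻¹(γ)` is clopen, so `A(G)_γ` is spanned by the `1_B` with `B ⊆ c⁻¹(γ)`
a compact open bisection (`mem_map_steinbergPiece`). As `λ(1_B) λ(1_C) = λ(1_{BC})` and `λ(1_B)* =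
λ(1_{B⁻¹})`, the cocycle identity fixes the degrees, and continuity passes to closures.

For density, the Schur test bounds `‖λ(f)‖` by the sup norm when `f` lives on one bisection
(`norm_regularRep_le`), and there `f` is a uniform limit of Steinberg functions
(`exists_steinbergOn_norm_sub_le`). Hence the operators of `A(G)` are dense. Finally `A(G)` is the
sum of its pieces, because a compact bisection meets only finitely many sets `c⁻¹(γ)`. -/

namespace TopologicalGroupoid

/-! ### Groupoid algebra: cancellation, products of sets, cocycles -/

section Algebra

variable {G : Type*} [TopologicalSpace G] [TopologicalGroupoid G]

theorem inv_mul_mul {x y : G} (h : src x = rng y) : x⁻¹ * (x * y) = y := by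
  rw [← TopologicalGroupoid.mul_assoc _ _ _ (src_inv x) h, inv_mul, h, rng_mul_self]

theorem mul_mul_inv {x y : G} (h : src x = rng y) : x * y * y⁻¹ = x := by
  rw [TopologicalGroupoid.mul_assoc _ _ _ h (rng_inv y).symm, mul_inv, ← h, mul_src]

theorem mul_inv_mul_self {x y : G} (h : src x = src y) : x * y⁻¹ * y = x := by
  rw [TopologicalGroupoid.mul_assoc _ _ _ (by rw [rng_inv, h]) (src_inv y), inv_mul, ← h, mul_src]

theorem mul_left_cancel {x y z : G} (hy : src x = rng y) (hz : src x = rng z)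
    (h : x * y = x * z) : y = z := by
  rw [← inv_mul_mul hy, h, inv_mul_mul hz]

/-- The product of the composable pairs in `B × C`. -/
def setMul (B C : Set G) : Set G := {x | ∃ b ∈ B, ∃ c ∈ C, src b = rng c ∧ b * c = x}

theorem IsCocycle.map_inv {Γ : Type*} [Group Γ] {c : G → Γ} (hc : IsCocycle c) (x : G) :
    c x⁻¹ = (c x)⁻¹ := by
  have h := hc (rng x) x (src_rng x)
  rw [rng_mul_self, right_eq_mul] at h
  rw [eq_inv_iff_mul_eq_one, ← hc _ _ (src_inv x), inv_mul]
  have h' := hc x (src x) (rng_src x).symm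
  rwa [mul_src, left_eq_mul] at h'

end Algebra

/-! ### Topology of bisections over a Hausdorff unit space -/

section Topology

variable {G : Type*} [TopologicalSpace G] [TopologicalGroupoid G]

theorem continuous_rng : Continuous (rng : G → G) := by
  have h : Continuous fun x : G => x * x⁻¹ :=
    continuousOn_mul.comp_continuous (continuous_id.prodMk continuous_inv)
      fun x => (rng_inv x).symm
  exact h.congr mul_inv

theorem continuous_src : Continuous (src : G → G) := by
  have h : Continuous fun x : G => x⁻¹ * x :=
    continuousOn_mul.comp_continuous (continuous_inv.prodMk continuous_id) src_inv
  exact h.congr inv_mul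

theorem continuous_srcUnit : Continuous (srcUnit : G → UnitSpace G) :=
  continuous_src.subtype_mk _

theorem continuous_rngUnit : Continuous (rngUnit : G → UnitSpace G) :=
  continuous_rng.subtype_mk _

theorem IsOpenBisection.eq_of_src {B : Set G} (hB : IsOpenBisection B) {x y : G} (hx : x ∈ B)
    (hy : y ∈ B) (h : src x = src y) : x = y :=
  congrArg Subtype.val (@hB.src_emb.injective ⟨x, hx⟩ ⟨y, hy⟩ (Subtype.ext h))

theorem IsOpenBisection.eq_of_rng {B : Set G} (hB : IsOpenBisection B) {x y : G} (hx : x ∈ B)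
    (hy : y ∈ B) (h : rng x = rng y) : x = y :=
  congrArg Subtype.val (@hB.rng_emb.injective ⟨x, hx⟩ ⟨y, hy⟩ (Subtype.ext h))

theorem isOpenMap_srcUnit [IsAmple G] : IsOpenMap (srcUnit : G → UnitSpace G) := by
  rw [IsAmple.isTopologicalBasis.isOpenMap_iff]
  rintro B ⟨hB, -⟩
  rw [Set.image_eq_range]
  exact hB.src_emb.isOpen_range

theorem isOpenMap_rngUnit [IsAmple G] : IsOpenMap (rngUnit : G → UnitSpace G) := by
  rw [IsAmple.isTopologicalBasis.isOpenMap_iff]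
  rintro B ⟨hB, -⟩
  rw [Set.image_eq_range]
  exact hB.rng_emb.isOpen_range

/-- In an ample groupoid source and range are open maps, so injectivity is all that remains to check
for an open set. -/
theorem isOpenBisection_of_injOn [IsAmple G] {B : Set G} (hB : IsOpen B)
    (hs : Set.InjOn src B) (hr : Set.InjOn rng B) : IsOpenBisection B where
  isOpen := hB
  src_emb := .of_continuous_injective_isOpenMap
    (continuous_srcUnit.comp continuous_subtype_val)
    (fun x y h => Subtype.ext (hs x.2 y.2 (congrArg Subtype.val h)))
    (isOpenMap_srcUnit.comp hB.isOpenMap_subtype_val)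
  rng_emb := .of_continuous_injective_isOpenMap
    (continuous_rngUnit.comp continuous_subtype_val)
    (fun x y h => Subtype.ext (hr x.2 y.2 (congrArg Subtype.val h)))
    (isOpenMap_rngUnit.comp hB.isOpenMap_subtype_val)

theorem IsOpenBisection.mono [IsAmple G] {B C : Set G} (hB : IsOpenBisection B) (hC : IsOpen C)
    (h : C ⊆ B) : IsOpenBisection C :=
  isOpenBisection_of_injOn hC (fun _ hx _ hy => hB.eq_of_src (h hx) (h hy))
    (fun _ hx _ hy => hB.eq_of_rng (h hx) (h hy))

theorem IsOpenBisection.preimage_inv [IsAmple G] {B : Set G} (hB : IsOpenBisection B) :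
    IsOpenBisection ((fun x : G => x⁻¹) ⁻¹' B) := by
  refine isOpenBisection_of_injOn (hB.isOpen.preimage continuous_inv) (fun x hx y hy h => ?_)
    (fun x hx y hy h => ?_)
  · have hxy : x⁻¹ = y⁻¹ := hB.eq_of_rng hx hy (by rw [rng_inv, rng_inv, h])
    rw [← inv_inv' x, hxy, inv_inv']
  · have hxy : x⁻¹ = y⁻¹ := hB.eq_of_src hx hy (by rw [src_inv, src_inv, h])
    rw [← inv_inv' x, hxy, inv_inv']

theorem isCompact_preimage_inv {B : Set G} (hB : IsCompact B) :
    IsCompact ((fun x : G => x⁻¹) ⁻¹' B) := by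
  have h : (fun x : G => x⁻¹) ⁻¹' B = (fun x : G => x⁻¹) '' B :=
    (congrFun (Set.image_eq_preimage_of_inverse inv_inv' inv_inv') B).symm
  rw [h]
  exact hB.image continuous_inv

/-- Since `G⁽⁰⁾` is Hausdorff, the composable pairs form a closed set, so those in `B × C` are
compact and multiplication carries them to `BC`. -/
theorem isCompact_setMul [T2Space (UnitSpace G)] {B C : Set G} (hB : IsCompact B)
    (hC : IsCompact C) : IsCompact (setMul B C) := by
  have hcl : IsClosed {p : G × G | srcUnit p.1 = rngUnit p.2} :=
    isClosed_eq (continuous_srcUnit.comp continuous_fst) (continuous_rngUnit.comp continuous_snd)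
  have h := ((hB.prod hC).inter_right hcl).image_of_continuousOn
    (f := fun p : G × G => p.1 * p.2)
    (continuousOn_mul.mono fun p hp => congrArg Subtype.val hp.2)
  convert h using 1
  ext x
  constructor
  · rintro ⟨b, hb, c, hc, h, rfl⟩
    exact ⟨(b, c), ⟨⟨hb, hc⟩, Subtype.ext h⟩, rfl⟩
  · rintro ⟨⟨b, c⟩, ⟨⟨hb, hc⟩, h⟩, rfl⟩
    exact ⟨b, hb, c, hc, congrArg Subtype.val h, rfl⟩

/-- Let `c(x)` be the unique element of `C` with the source of `x`. It depends continuously on `x`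
in the open set where `src x ∈ src C`, and `BC` is the preimage of `B` under `x ↦ x * c(x)⁻¹`. -/
theorem IsOpenBisection.isOpen_setMul {B C : Set G} (hB : IsOpen B) (hC : IsOpenBisection C) :
    IsOpen (setMul B C) := by
  -- The local inverse of the source map, as a total function into `C`, needs `C` nonempty.
  rcases C.eq_empty_or_nonempty with rfl | ⟨c₀, hc₀⟩
  · convert isOpen_empty (X := G)
    ext x
    simp [setMul]
  have : Nonempty C := ⟨⟨c₀, hc₀⟩⟩
  set e := hC.src_emb.toOpenPartialHomeomorph with he
  have hright : ∀ x : G, srcUnit x ∈ e.target → src (e.symm (srcUnit x) : G) = src x :=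
    fun x hx => congrArg Subtype.val (e.right_inv hx)
  have hU : IsOpen (srcUnit ⁻¹' e.target : Set G) := e.open_target.preimage continuous_srcUnit
  have hφ : ContinuousOn (fun x : G => x * (e.symm (srcUnit x) : G)⁻¹) (srcUnit ⁻¹' e.target) := by
    refine continuousOn_mul.comp (f := fun x : G => (x, (e.symm (srcUnit x) : G)⁻¹))
      (continuousOn_id.prodMk (continuous_inv.comp_continuousOn
        (continuous_subtype_val.comp_continuousOn
          (e.continuousOn_symm.comp continuous_srcUnit.continuousOn fun x hx => hx)))) ?_
    intro x hx
    simp [rng_inv, hright x hx]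
  convert hφ.isOpen_inter_preimage hU hB using 1
  ext x
  constructor
  · rintro ⟨b, hb, c, hc, h, rfl⟩
    have hmem : srcUnit (b * c) ∈ e.target := by
      rw [he, Topology.IsOpenEmbedding.toOpenPartialHomeomorph_target]
      exact ⟨⟨c, hc⟩, Subtype.ext (src_mul _ _ h).symm⟩
    refine ⟨hmem, ?_⟩
    have : (e.symm (srcUnit (b * c)) : G) = c :=
      hC.eq_of_src (Subtype.coe_prop _) hc ((hright _ hmem).trans (src_mul _ _ h))
    simpa [this, mul_mul_inv h] using hb
  · rintro ⟨hx, hb⟩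
    have hs := hright x hx
    refine ⟨_, hb, _, (e.symm (srcUnit x)).2, ?_, mul_inv_mul_self hs.symm⟩
    rw [src_mul _ _ (by rw [rng_inv, hs]), src_inv]

theorem IsOpenBisection.setMul [IsAmple G] {B C : Set G} (hB : IsOpenBisection B)
    (hC : IsOpenBisection C) : IsOpenBisection (setMul B C) := by
  refine isOpenBisection_of_injOn (IsOpenBisection.isOpen_setMul hB.isOpen hC) ?_ ?_
  · rintro _ ⟨b, hb, c, hc, h, rfl⟩ _ ⟨b', hb', c', hc', h', rfl⟩ hs
    rw [src_mul _ _ h, src_mul _ _ h'] at hs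
    obtain rfl := hC.eq_of_src hc hc' hs
    rw [hB.eq_of_src hb hb' (h.trans h'.symm)]
  · rintro _ ⟨b, hb, c, hc, h, rfl⟩ _ ⟨b', hb', c', hc', h', rfl⟩ hs
    rw [rng_mul _ _ h, rng_mul _ _ h'] at hs
    obtain rfl := hB.eq_of_rng hb hb' hs
    rw [hC.eq_of_rng hc hc' (h.symm.trans h')]

/-- Compact sets need not be closed in `G`, but `U` embeds in the Hausdorff space `G⁽⁰⁾`, so they
are closed relative to `U`. -/
theorem IsOpenBisection.isOpen_isCompact_diff [T2Space (UnitSpace G)] {U V W : Set G}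
    (hU : IsOpenBisection U) (hV : IsOpen V) (hVc : IsCompact V) (hVU : V ⊆ U) (hW : IsOpen W)
    (hWc : IsCompact W) (hWU : W ⊆ U) : IsOpen (V \ W) ∧ IsCompact (V \ W) := by
  have : T2Space U := hU.src_emb.isEmbedding.t2Space
  have hval : Topology.IsInducing (Subtype.val : U → G) := .subtypeVal
  have hVc' : IsCompact (Subtype.val ⁻¹' V : Set U) := by
    rw [hval.isCompact_iff, Subtype.image_preimage_coe, Set.inter_eq_right.2 hVU]
    exact hVc
  have hWc' : IsCompact (Subtype.val ⁻¹' W : Set U) := by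
    rw [hval.isCompact_iff, Subtype.image_preimage_coe, Set.inter_eq_right.2 hWU]
    exact hWc
  have himage : V \ W = Subtype.val '' (Subtype.val ⁻¹' V \ Subtype.val ⁻¹' W : Set U) := by
    rw [← Set.preimage_sdiff, Subtype.image_preimage_coe,
      Set.inter_eq_right.2 (Set.sdiff_subset.trans hVU)]
  rw [himage]
  exact ⟨hU.isOpen.isOpenMap_subtype_val _
      ((hV.preimage continuous_subtype_val).sdiff hWc'.isClosed),
    (hVc'.diff (hW.preimage continuous_subtype_val)).image continuous_subtype_val⟩

end Topology

end TopologicalGroupoid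

namespace TopologicalGroupoid

/-! ### Matrix entries of operators on `ℓ²` -/

section Operators

/-- The Schur test with its constant, which the construction of `kernelOperator` hides behind an
existential. -/
theorem norm_kernelOperator_le {ι : Type*} {k : ι → ι → ℂ} (hk : IsBoundedKernel k) (C : NNReal)
    (h1 : ∀ x, ∑' z, ‖k x z‖ₑ ≤ C) (h2 : ∀ z, ∑' x, ‖k x z‖ₑ ≤ C) :
    ‖kernelOperator k hk‖ ≤ C := by
  refine ContinuousLinearMap.opNorm_le_bound _ C.2 fun ξ => ?_
  refine (sq_le_sq₀ (norm_nonneg _) (mul_nonneg C.2 (norm_nonneg _))).1 ?_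
  have hC : (C : ℝ≥0∞) ^ 2 * ENNReal.ofReal (‖ξ‖ ^ 2) = ENNReal.ofReal ((C * ‖ξ‖) ^ 2) := by
    rw [mul_pow, ENNReal.ofReal_mul (by positivity), ENNReal.ofReal_pow (NNReal.coe_nonneg C),
      ENNReal.ofReal_coe_nnreal]
  have h := schur_bound k C h1 h2 ξ
  rw [l2_enorm_sq, hC] at h
  exact (ENNReal.ofReal_le_ofReal_iff (by positivity)).1 ((l2_enorm_sq _).ge.trans h)

open scoped Classical in
/-- The matrix coefficient of an operator on `ℓ²` at a pair of indices. -/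
noncomputable def matrixEntry {ι : Type*} (x z : ι) :
    (lp (fun _ : ι => ℂ) 2 →L[ℂ] lp (fun _ : ι => ℂ) 2) →ₗ[ℂ] ℂ where
  toFun T := (T (lp.single 2 z 1) : ι → ℂ) x
  map_add' _ _ := rfl
  map_smul' _ _ := rfl

/-- Frees the entry from the classical decidability instance chosen in its definition. -/
theorem matrixEntry_apply {ι : Type*} [inst : DecidableEq ι] (x z : ι)
    (T : lp (fun _ : ι => ℂ) 2 →L[ℂ] lp (fun _ : ι => ℂ) 2) :
    matrixEntry x z T = (T (lp.single 2 z 1) : ι → ℂ) x := by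
  obtain rfl : inst = fun a b => Classical.propDecidable (a = b) := Subsingleton.elim _ _
  rfl

theorem continuous_matrixEntry {ι : Type*} (x z : ι) : Continuous (matrixEntry (ι := ι) x z) := by
  classical
  refine AddMonoidHomClass.continuous_of_bound (matrixEntry (ι := ι) x z) 1 fun T => ?_
  have h : ‖matrixEntry x z T‖ ≤ ‖T (lp.single 2 z 1)‖ := by
    rw [matrixEntry_apply]
    exact lp.norm_apply_le_norm (by norm_num) (T (lp.single 2 z (1 : ℂ))) x
  refine h.trans ((T.le_opNorm _).trans ?_)
  rw [lp.norm_single (by norm_num)]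
  simp

/-- The expansion `ξ = ∑ ξ(z) e_z` converges in norm and bounded operators respect it, so agreement
on the `e_z` suffices. -/
theorem ext_matrixEntry {ι : Type*} {S T : lp (fun _ : ι => ℂ) 2 →L[ℂ] lp (fun _ : ι => ℂ) 2}
    (h : ∀ x z, matrixEntry x z S = matrixEntry x z T) : S = T := by
  classical
  have key : ∀ z (a : ℂ), S (lp.single 2 z a) = T (lp.single 2 z a) := fun z a => by
    have h1 : S (lp.single 2 z 1) = T (lp.single 2 z 1) := by
      ext x
      rw [← matrixEntry_apply, ← matrixEntry_apply, h]
    have ha : lp.single (E := fun _ : ι => ℂ) 2 z a = a • lp.single 2 z 1 := by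
      rw [← lp.single_smul, smul_eq_mul, mul_one]
    rw [ha, map_smul, map_smul, h1]
  ext1 ξ
  have hξ := lp.hasSum_single (by norm_num) ξ
  refine (hξ.mapL S).unique ?_
  simpa only [key] using hξ.mapL T

theorem matrixEntry_kernelOperator {ι : Type*} {k : ι → ι → ℂ} (hk : IsBoundedKernel k)
    (x z : ι) : matrixEntry x z (kernelOperator k hk) = k x z := by
  classical
  rw [matrixEntry_apply, kernelOperator_apply, tsum_eq_single z]
  · simp
  · intro y hy
    simp [lp.single_apply, Pi.single_eq_of_ne hy]

theorem matrixEntry_star {ι : Type*} (T : lp (fun _ : ι => ℂ) 2 →L[ℂ] lp (fun _ : ι => ℂ) 2)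
    (x z : ι) : matrixEntry x z (star T) = star (matrixEntry z x T) := by
  classical
  have h1 := lp.inner_single_left (𝕜 := ℂ) x (1 : ℂ) (star T (lp.single 2 z (1 : ℂ)))
  have h2 := lp.inner_single_right (𝕜 := ℂ) z (1 : ℂ) (T (lp.single 2 x (1 : ℂ)))
  rw [ContinuousLinearMap.star_eq_adjoint, ContinuousLinearMap.adjoint_inner_right, h2] at h1
  simp only [RCLike.inner_apply, map_one, mul_one, one_mul] at h1
  rw [ContinuousLinearMap.star_eq_adjoint, matrixEntry_apply, matrixEntry_apply, ← h1]
  rfl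

end Operators

/-! ### Operators of compact open bisections -/

section BisectionOperators

variable {G : Type*} [TopologicalSpace G] [TopologicalGroupoid G]

theorem matrixEntry_regularRep (f : compactlySupported G) (x z : G) :
    matrixEntry x z (regularRep G f) = kernel (f : G → ℂ) x z :=
  matrixEntry_kernelOperator (isBoundedKernel_of_mem f.2) x z

theorem kernel_eq_zero {f : G → ℂ} {S : Set G} (hf : Function.support f ⊆ S) {x z : G}
    (h : ¬ (src x = src z ∧ x * z⁻¹ ∈ S)) : kernel f x z = 0 := by
  unfold kernel
  split_ifs with h1
  · by_contra h2
    exact h ⟨h1, hf h2⟩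
  · rfl

/-- Each row and column of the matrix has at most one nonzero entry, as an element of `U` is
determined by its range and by its source. The Schur constant is therefore the sup bound. -/
theorem norm_regularRep_le {U : Set G} (hU : IsOpenBisection U) (f : compactlySupported G)
    (hf : Function.support (f : G → ℂ) ⊆ U) (C : NNReal) (hC : ∀ x, ‖(f : G → ℂ) x‖ ≤ C) :
    ‖regularRep G f‖ ≤ C := by
  have hke : ∀ x z, ‖kernel (f : G → ℂ) x z‖ₑ ≤ (C : ℝ≥0∞) := fun x z => by
    unfold kernel
    split_ifs
    · rw [← ofReal_norm, ← ENNReal.ofReal_coe_nnreal]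
      exact ENNReal.ofReal_le_ofReal (hC _)
    · simp
  have hne : ∀ x z, ‖kernel (f : G → ℂ) x z‖ₑ ≠ 0 → src x = src z ∧ x * z⁻¹ ∈ U := fun x z h => by
    by_contra h'
    exact h (by rw [kernel_eq_zero hf h', enorm_zero])
  refine norm_kernelOperator_le (isBoundedKernel_of_mem f.2) C (fun x => ?_) fun z => ?_
  · refine tsum_le_of_subsingleton_support _ _ (hke x) fun y z hy hz => ?_
    obtain ⟨hy1, hy2⟩ := hne _ _ hy
    obtain ⟨hz1, hz2⟩ := hne _ _ hz
    refine mul_inv_cancel_left' hy1 hz1 (hU.eq_of_rng hy2 hz2 ?_)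
    rw [rng_mul _ _ (by rw [rng_inv, hy1]), rng_mul _ _ (by rw [rng_inv, hz1])]
  · refine tsum_le_of_subsingleton_support _ _ (fun x => hke x z) fun x y hx hy => ?_
    obtain ⟨hx1, hx2⟩ := hne _ _ hx
    obtain ⟨hy1, hy2⟩ := hne _ _ hy
    refine mul_inv_cancel_right' hx1 hy1 (hU.eq_of_src hx2 hy2 ?_)
    rw [src_mul _ _ (by rw [rng_inv, hx1]), src_mul _ _ (by rw [rng_inv, hy1])]

theorem indicator_mem_steinbergAlgebra {B : Set G} (hB : IsOpenBisection B) (hK : IsCompact B) :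
    B.indicator (fun _ => (1 : ℂ)) ∈ steinbergAlgebra G :=
  Submodule.subset_span ⟨B, hB, hK, rfl⟩

/-- The operator of the characteristic function of a compact open bisection. -/
noncomputable def bisectionOperator {B : Set G} (hB : IsOpenBisection B) (hK : IsCompact B) :
    L2 G →L[ℂ] L2 G :=
  regularRep G ⟨B.indicator fun _ => 1,
    steinbergAlgebra_le G (indicator_mem_steinbergAlgebra hB hK)⟩

open scoped Classical in
theorem kernel_indicator (B : Set G) (x z : G) :
    kernel (B.indicator fun _ => 1) x z = if ∃ b ∈ B, src b = rng z ∧ b * z = x then 1 else 0 := by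
  by_cases h : ∃ b ∈ B, src b = rng z ∧ b * z = x
  · obtain ⟨b, hb, hbz, rfl⟩ := id h
    rw [if_pos h, kernel, if_pos (src_mul _ _ hbz), mul_mul_inv hbz, Set.indicator_of_mem hb]
  · rw [if_neg h]
    refine kernel_eq_zero Set.support_indicator_subset fun ⟨h1, h2⟩ => h ⟨_, h2, ?_, ?_⟩
    · rw [src_mul _ _ (by rw [rng_inv, h1]), src_inv]
    · exact mul_inv_mul_self h1

/-- The range of `b * z` determines `b` within `B`, and then cancellation determines `z`; the
defining sum has one nonzero coefficient. -/
theorem bisectionOperator_apply_mul {B : Set G} (hB : IsOpenBisection B) (hK : IsCompact B)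
    (ξ : L2 G) {b z : G} (hb : b ∈ B) (h : src b = rng z) :
    (bisectionOperator hB hK ξ : G → ℂ) (b * z) = ξ z := by
  classical
  rw [bisectionOperator, regularRep_apply, tsum_eq_single z, kernel_indicator,
    if_pos ⟨b, hb, h, rfl⟩, one_mul]
  intro y hy
  rw [kernel_indicator, if_neg, zero_mul]
  rintro ⟨b', hb', h', he⟩
  obtain rfl := hB.eq_of_rng hb' hb (by rw [← rng_mul _ _ h', he, rng_mul _ _ h])
  exact hy (mul_left_cancel h' h he)

theorem bisectionOperator_apply_eq_zero {B : Set G} (hB : IsOpenBisection B) (hK : IsCompact B)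
    (ξ : L2 G) {x : G} (h : ∀ b ∈ B, ∀ z, src b = rng z → b * z ≠ x) :
    (bisectionOperator hB hK ξ : G → ℂ) x = 0 := by
  classical
  rw [bisectionOperator, regularRep_apply]
  refine (tsum_congr fun z => ?_).trans tsum_zero
  rw [kernel_indicator, if_neg, zero_mul]
  rintro ⟨b, hb, hbz, he⟩
  exact h b hb z hbz he

theorem bisectionOperator_mul [IsAmple G] [T2Space (UnitSpace G)] {B C : Set G}
    (hB : IsOpenBisection B) (hBK : IsCompact B) (hC : IsOpenBisection C) (hCK : IsCompact C) :
    bisectionOperator hB hBK * bisectionOperator hC hCK =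
      bisectionOperator (hB.setMul hC) (isCompact_setMul hBK hCK) := by
  ext ξ x
  rw [mul_apply_eq_comp]
  by_cases hx : ∃ b ∈ B, ∃ z, src b = rng z ∧ b * z = x
  · obtain ⟨b, hb, y, hby, rfl⟩ := hx
    rw [bisectionOperator_apply_mul hB hBK _ hb hby]
    by_cases hy : ∃ c ∈ C, ∃ z, src c = rng z ∧ c * z = y
    · obtain ⟨c, hc, z, hcz, rfl⟩ := hy
      rw [rng_mul _ _ hcz] at hby
      rw [bisectionOperator_apply_mul hC hCK _ hc hcz,
        ← TopologicalGroupoid.mul_assoc _ _ _ hby hcz,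
        bisectionOperator_apply_mul (hB.setMul hC) _ _ (b := b * c) ⟨b, hb, c, hc, hby, rfl⟩
          (by rw [src_mul _ _ hby, hcz])]
    · push Not at hy
      rw [bisectionOperator_apply_eq_zero hC hCK _ hy, bisectionOperator_apply_eq_zero]
      rintro _ ⟨b', hb', c, hc, h, rfl⟩ z hz he
      rw [src_mul _ _ h] at hz
      have hcz : src b' = rng (c * z) := by rw [rng_mul _ _ hz, h]
      rw [TopologicalGroupoid.mul_assoc _ _ _ h hz] at he
      -- A factorisation of `b * y` through `BC` must begin with `b` itself, so it would factor `y`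
      -- through `C`.
      obtain rfl := hB.eq_of_rng hb' hb (by rw [← rng_mul _ _ hcz, he, rng_mul _ _ hby])
      exact hy c hc z hz (mul_left_cancel hcz hby he)
  · push Not at hx
    rw [bisectionOperator_apply_eq_zero hB hBK _ hx, bisectionOperator_apply_eq_zero]
    rintro _ ⟨b, hb, c, hc, h, rfl⟩ z hz he
    rw [src_mul _ _ h] at hz
    rw [TopologicalGroupoid.mul_assoc _ _ _ h hz] at he
    exact hx b hb _ (by rw [rng_mul _ _ hz, h]) he

theorem star_bisectionOperator [IsAmple G] {B : Set G} (hB : IsOpenBisection B)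
    (hK : IsCompact B) :
    star (bisectionOperator hB hK) =
      bisectionOperator hB.preimage_inv (isCompact_preimage_inv hK) := by
  classical
  refine ext_matrixEntry fun x z => ?_
  have hiff : (∃ b ∈ B, src b = rng x ∧ b * x = z) ↔
      ∃ b ∈ (fun x : G => x⁻¹) ⁻¹' B, src b = rng z ∧ b * z = x := by
    constructor
    · rintro ⟨b, hb, h, rfl⟩
      exact ⟨b⁻¹, by simpa [inv_inv'] using hb, by rw [src_inv, rng_mul _ _ h], inv_mul_mul h⟩
    · rintro ⟨b, hb, h, rfl⟩
      exact ⟨b⁻¹, hb, by rw [src_inv, rng_mul _ _ h], inv_mul_mul h⟩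
  rw [matrixEntry_star, bisectionOperator, bisectionOperator, matrixEntry_regularRep,
    matrixEntry_regularRep, kernel_indicator, kernel_indicator]
  simp only [hiff]
  split_ifs <;> simp

end BisectionOperators

end TopologicalGroupoid

namespace TopologicalGroupoid

/-! ### Spans of bisections inside a given set -/

section Span

variable {G : Type*} [TopologicalSpace G] [TopologicalGroupoid G]

/-- The span of the characteristic functions of the compact open bisections contained in `S`. -/
def steinbergOn (S : Set G) : Submodule ℂ (G → ℂ) :=
  Submodule.span ℂ {f | ∃ B ⊆ S, IsOpenBisection B ∧ IsCompact B ∧ f = B.indicator fun _ => 1}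

theorem steinbergOn_le (S : Set G) : steinbergOn S ≤ steinbergAlgebra G :=
  Submodule.span_mono fun _ ⟨B, _, h⟩ => ⟨B, h⟩

theorem steinbergOn_univ : steinbergOn (Set.univ : Set G) = steinbergAlgebra G :=
  le_antisymm (steinbergOn_le _) (Submodule.span_mono fun _ ⟨B, h⟩ => ⟨B, Set.subset_univ B, h⟩)

theorem support_subset_of_mem_steinbergOn {S : Set G} {f : G → ℂ} (hf : f ∈ steinbergOn S) :
    Function.support f ⊆ S := by
  induction hf using Submodule.span_induction with
  | zero => simp
  | add f g _ _ hf hg => exact (Function.support_add f g).trans (Set.union_subset hf hg)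
  | smul a f _ hf => exact (Function.support_const_smul_subset a f).trans hf
  | mem f hf =>
    obtain ⟨B, hBS, -, -, rfl⟩ := hf
    exact Set.support_indicator_subset.trans hBS

/-- Serves twice: to cut along the clopen set `c⁻¹(γ)`, and to make overlapping pieces disjoint in
the approximation argument. -/
theorem indicator_mem_steinbergOn {S T V : Set G} {f : G → ℂ} (hf : f ∈ steinbergOn S)
    (h : ∀ B ⊆ S, IsOpenBisection B → IsCompact B →
      B ∩ V ⊆ T ∧ IsOpenBisection (B ∩ V) ∧ IsCompact (B ∩ V)) :
    V.indicator f ∈ steinbergOn T := by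
  induction hf using Submodule.span_induction with
  | zero => simp
  | add f g _ _ hf hg => rw [Set.indicator_add']; exact add_mem hf hg
  | smul a f _ hf =>
    have : V.indicator (a • f) = a • V.indicator f := Set.indicator_const_smul V a f
    rw [this]
    exact Submodule.smul_mem _ a hf
  | mem f hf =>
    obtain ⟨B, hBS, hB, hK, rfl⟩ := hf
    obtain ⟨h1, h2, h3⟩ := h B hBS hB hK
    refine Submodule.subset_span ⟨_, h1, h2, h3, ?_⟩
    rw [Set.indicator_indicator, Set.inter_comm]

/-- The span of the operators of the compact open bisections contained in `S`. -/
noncomputable def operatorsOn (S : Set G) : Submodule ℂ (L2 G →L[ℂ] L2 G) :=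
  Submodule.span ℂ {T | ∃ B ⊆ S, ∃ (hB : IsOpenBisection B) (hK : IsCompact B),
    T = bisectionOperator hB hK}

theorem regularRep_mem_operatorsOn {S : Set G} {f : G → ℂ} (hf : f ∈ steinbergOn S)
    (hf' : f ∈ compactlySupported G) : regularRep G ⟨f, hf'⟩ ∈ operatorsOn S := by
  induction hf using Submodule.span_induction with
  | zero =>
    have : (⟨0, hf'⟩ : compactlySupported G) = 0 := rfl
    rw [this, map_zero]
    exact zero_mem _
  | add f g hf hg ihf ihg =>
    have hf1 := steinbergAlgebra_le G (steinbergOn_le S hf)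
    have hg1 := steinbergAlgebra_le G (steinbergOn_le S hg)
    have : (⟨f + g, hf'⟩ : compactlySupported G) = ⟨f, hf1⟩ + ⟨g, hg1⟩ := rfl
    rw [this, map_add]
    exact add_mem (ihf hf1) (ihg hg1)
  | smul a f hf ihf =>
    have hf1 := steinbergAlgebra_le G (steinbergOn_le S hf)
    have : (⟨a • f, hf'⟩ : compactlySupported G) = a • ⟨f, hf1⟩ := rfl
    rw [this, map_smul]
    exact Submodule.smul_mem _ a (ihf hf1)
  | mem f hf =>
    obtain ⟨B, hBS, hB, hK, rfl⟩ := hf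
    exact Submodule.subset_span ⟨B, hBS, hB, hK, rfl⟩

theorem exists_regularRep_eq {S : Set G} {T : L2 G →L[ℂ] L2 G} (hT : T ∈ operatorsOn S) :
    ∃ f ∈ steinbergOn S, ∃ h : f ∈ compactlySupported G, regularRep G ⟨f, h⟩ = T := by
  induction hT using Submodule.span_induction with
  | zero => exact ⟨0, zero_mem _, zero_mem _, map_zero (regularRep G)⟩
  | add T T' _ _ hT hT' =>
    obtain ⟨f, hf, h, rfl⟩ := hT
    obtain ⟨g, hg, h', rfl⟩ := hT'
    exact ⟨f + g, add_mem hf hg, add_mem h h', map_add (regularRep G) ⟨f, h⟩ ⟨g, h'⟩⟩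
  | smul a T _ hT =>
    obtain ⟨f, hf, h, rfl⟩ := hT
    exact ⟨a • f, Submodule.smul_mem _ a hf, Submodule.smul_mem _ a h,
      map_smul (regularRep G) a ⟨f, h⟩⟩
  | mem T hT =>
    obtain ⟨B, hBS, hB, hK, rfl⟩ := hT
    exact ⟨_, Submodule.subset_span ⟨B, hBS, hB, hK, rfl⟩, _, rfl⟩

theorem mul_mem_operatorsOn [IsAmple G] [T2Space (UnitSpace G)] {S S' R : Set G}
    (h : ∀ x ∈ S, ∀ y ∈ S', src x = rng y → x * y ∈ R) {T T' : L2 G →L[ℂ] L2 G}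
    (hT : T ∈ operatorsOn S) (hT' : T' ∈ operatorsOn S') : T * T' ∈ operatorsOn R := by
  have hle : operatorsOn S * operatorsOn S' ≤ operatorsOn R := by
    rw [operatorsOn, operatorsOn, Submodule.span_mul_span, Submodule.span_le]
    rintro _ ⟨_, ⟨B, hBS, hB, hBK, rfl⟩, _, ⟨C, hCS, hC, hCK, rfl⟩, rfl⟩
    refine Submodule.subset_span ⟨setMul B C, ?_, hB.setMul hC, isCompact_setMul hBK hCK,
      bisectionOperator_mul hB hBK hC hCK⟩
    rintro _ ⟨b, hb, c, hc, hbc, rfl⟩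
    exact h b (hBS hb) c (hCS hc) hbc
  exact hle (Submodule.mul_mem_mul hT hT')

theorem star_mem_operatorsOn [IsAmple G] {S R : Set G} (h : ∀ x, x⁻¹ ∈ S → x ∈ R)
    {T : L2 G →L[ℂ] L2 G} (hT : T ∈ operatorsOn S) : star T ∈ operatorsOn R := by
  induction hT using Submodule.span_induction with
  | zero => rw [star_zero]; exact zero_mem _
  | add T T' _ _ hT hT' => rw [star_add]; exact add_mem hT hT'
  | smul a T _ hT => rw [star_smul]; exact Submodule.smul_mem _ _ hT
  | mem T hT =>
    obtain ⟨B, hBS, hB, hK, rfl⟩ := hT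
    exact Submodule.subset_span ⟨_, fun x hx => h x (hBS hx), _, _, star_bisectionOperator hB hK⟩

end Span

/-! ### Density of the Steinberg algebra -/

section Density

variable {G : Type*} [TopologicalSpace G] [TopologicalGroupoid G] [IsAmple G]
  [T2Space (UnitSpace G)]

/-- Compact induction on `K`: near a point a constant on a small compact open bisection suffices,
and two approximants are glued by keeping the first on `V` and the second on `W \ V`. The estimate
holds on all of `W ⊇ K`, and off `W` both functions vanish. -/
theorem exists_steinbergOn_norm_sub_le {U K : Set G} (hU : IsOpenBisection U) {f : G → ℂ}
    (hf : ContinuousOn f U) (hKU : K ⊆ U) (hK : IsCompact K) (hfK : Function.support f ⊆ K)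
    {ε : ℝ} (hε : 0 < ε) : ∃ g ∈ steinbergOn U, ∀ x, ‖f x - g x‖ ≤ ε := by
  have key : ∃ W ⊆ U, IsOpen W ∧ IsCompact W ∧ K ⊆ W ∧ ∃ g ∈ steinbergOn U,
      Function.support g ⊆ W ∧ ∀ x ∈ W, ‖f x - g x‖ ≤ ε := by
    refine hK.induction_on (p := fun K => ∃ W ⊆ U, IsOpen W ∧ IsCompact W ∧ K ⊆ W ∧
      ∃ g ∈ steinbergOn U, Function.support g ⊆ W ∧ ∀ x ∈ W, ‖f x - g x‖ ≤ ε) ?_ ?_ ?_ ?_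
    · exact ⟨∅, Set.empty_subset _, isOpen_empty, isCompact_empty, subset_rfl, 0, zero_mem _,
        by simp, by simp⟩
    · rintro s t hst ⟨W, h1, h2, h3, h4, h5⟩
      exact ⟨W, h1, h2, h3, hst.trans h4, h5⟩
    · rintro s t ⟨V, hVU, hVo, hVc, hsV, g, hg, hgV, hgf⟩ ⟨W, hWU, hWo, hWc, htW, k, hk, hkW, hkf⟩
      refine ⟨V ∪ W, Set.union_subset hVU hWU, hVo.union hWo, hVc.union hWc,
        Set.union_subset_union hsV htW, g + (W \ V).indicator k, add_mem hg ?_, ?_, ?_⟩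
      · refine indicator_mem_steinbergOn hk fun B hBU hB hBK => ?_
        obtain ⟨h1, h2⟩ := hU.isOpen_isCompact_diff hWo hWc hWU hVo hVc hVU
        -- An intersection of compact sets need not be compact in `G`, so `B ∩ (W \ V)` is treated
        -- as the iterated difference `B \ (B \ (W \ V))`.
        obtain ⟨h3, h4⟩ := hU.isOpen_isCompact_diff hB.isOpen hBK hBU h1 h2
          (Set.sdiff_subset.trans hWU)
        obtain ⟨h5, h6⟩ := hU.isOpen_isCompact_diff hB.isOpen hBK hBU h3 h4
          (Set.sdiff_subset.trans hBU)
        rw [sdiff_sdiff_right_self] at h5 h6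
        exact ⟨Set.inter_subset_left.trans hBU, hB.mono h5 Set.inter_subset_left, h6⟩
      · refine (Function.support_add _ _).trans (Set.union_subset_union hgV ?_)
        exact Set.support_indicator_subset.trans Set.sdiff_subset
      · intro x hx
        by_cases hxV : x ∈ V
        · simpa [hxV] using hgf x hxV
        · have hxW : x ∈ W := hx.resolve_left hxV
          have hgx : g x = 0 := by
            by_contra h
            exact hxV (hgV h)
          simpa [hxV, hxW, hgx] using hkf x hxW
    · intro x hx
      have hopen : IsOpen (U ∩ f ⁻¹' Metric.ball (f x) ε) :=
        hf.isOpen_inter_preimage hU.isOpen Metric.isOpen_ball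
      obtain ⟨B, ⟨hB, hBK⟩, hxB, hBU⟩ := IsAmple.isTopologicalBasis.exists_subset_of_mem_open
        (show x ∈ U ∩ f ⁻¹' Metric.ball (f x) ε from ⟨hKU hx, Metric.mem_ball_self hε⟩) hopen
      have hBU' : B ⊆ U := hBU.trans Set.inter_subset_left
      refine ⟨B, mem_nhdsWithin_of_mem_nhds (hB.isOpen.mem_nhds hxB), B, hBU', hB.isOpen, hBK,
        subset_rfl, f x • B.indicator fun _ => 1,
        Submodule.smul_mem _ _ (Submodule.subset_span ⟨B, hBU', hB, hBK, rfl⟩),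
        (Function.support_const_smul_subset _ _).trans Set.support_indicator_subset, ?_⟩
      intro y hy
      have := (hBU hy).2
      simp only [Set.mem_preimage, mem_ball_iff_norm] at this
      simpa [hy] using this.le
  obtain ⟨W, -, -, -, hKW, g, hg, hgW, hgf⟩ := key
  refine ⟨g, hg, fun x => ?_⟩
  by_cases hx : x ∈ W
  · exact hgf x hx
  · have hfx : f x = 0 := by
      by_contra h
      exact hx (hKW (hfK h))
    have hgx : g x = 0 := by
      by_contra h
      exact hx (hgW h)
    simpa [hfx, hgx] using hε.le

theorem regularRep_mem_closure (f : compactlySupported G) :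
    regularRep G f ∈ (operatorsOn (Set.univ : Set G)).topologicalClosure := by
  obtain ⟨f, hf⟩ := f
  -- The membership proof is bound inside the claim so that induction on the span runs over bare
  -- functions.
  suffices H : ∃ h : f ∈ compactlySupported G,
      regularRep G ⟨f, h⟩ ∈ (operatorsOn (Set.univ : Set G)).topologicalClosure from H.2
  induction hf using Submodule.span_induction with
  | zero =>
    refine ⟨zero_mem _, ?_⟩
    convert zero_mem (operatorsOn (Set.univ : Set G)).topologicalClosure
    exact map_zero (regularRep G)
  | add f g _ _ hf hg =>
    obtain ⟨h, hf⟩ := hf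
    obtain ⟨h', hg⟩ := hg
    refine ⟨add_mem h h', ?_⟩
    convert add_mem hf hg
    exact map_add (regularRep G) ⟨f, h⟩ ⟨g, h'⟩
  | smul a f _ hf =>
    obtain ⟨h, hf⟩ := hf
    refine ⟨Submodule.smul_mem _ a h, ?_⟩
    convert Submodule.smul_mem _ a hf
    exact map_smul (regularRep G) a ⟨f, h⟩
  | mem f hf =>
    refine ⟨Submodule.subset_span hf, ?_⟩
    obtain ⟨U, hU, hc, K, hKU, hK, hs⟩ := hf
    rw [← SetLike.mem_coe, Submodule.topologicalClosure_coe, Metric.mem_closure_iff]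
    intro ε hε
    obtain ⟨g, hg, hfg⟩ := exists_steinbergOn_norm_sub_le hU hc hKU hK hs (half_pos hε)
    have hg' := steinbergAlgebra_le G (steinbergOn_le U hg)
    refine ⟨regularRep G ⟨g, hg'⟩, regularRep_mem_operatorsOn
      (steinbergOn_univ.ge (steinbergOn_le U hg)) hg', ?_⟩
    rw [dist_eq_norm, ← map_sub]
    -- `f - g` is still supported in the single bisection `U`, so the sup bound controls the norm.
    refine lt_of_le_of_lt (norm_regularRep_le hU _ ?_ ⟨ε / 2, (half_pos hε).le⟩ hfg)
      (half_lt_self hε)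
    exact (Function.support_sub f g).trans
      (Set.union_subset (hs.trans hKU) (support_subset_of_mem_steinbergOn hg))

variable (G) in
/-- The operators of the Steinberg algebra. -/
noncomputable def steinbergOperators : NonUnitalStarSubalgebra ℂ (L2 G →L[ℂ] L2 G) where
  carrier := operatorsOn (Set.univ : Set G)
  zero_mem' := zero_mem _
  add_mem' := add_mem
  smul_mem' a _ h := Submodule.smul_mem _ a h
  mul_mem' := mul_mem_operatorsOn fun _ _ _ _ _ => Set.mem_univ _
  star_mem' := star_mem_operatorsOn fun _ _ => Set.mem_univ _

/-- The Steinberg operators already form a *-algebra, so it is enough that their closure contains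
the generators `λ(f)`. -/
theorem reducedCStarAlgebra_le :
    reducedCStarAlgebra G ≤ (steinbergOperators G).topologicalClosure := by
  refine NonUnitalStarSubalgebra.topologicalClosure_minimal _ ?_
    (NonUnitalStarSubalgebra.isClosed_topologicalClosure _)
  refine NonUnitalStarAlgebra.adjoin_le ?_
  rintro _ ⟨f, rfl⟩
  exact regularRep_mem_closure f

end Density

/-! ### The grading -/

section Grading

variable {G : Type*} [TopologicalSpace G] [TopologicalGroupoid G]

theorem coe_steinbergToReduced (f : steinbergAlgebra G) :
    (steinbergToReduced G f : L2 G →L[ℂ] L2 G) =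
      regularRep G ⟨f, steinbergAlgebra_le G f.2⟩ := rfl

variable {Γ : Type*} {c : G → Γ}

/-- The operators in `C*_r(G)` whose matrix is supported in `{(x, z) | src x = src z, x z⁻¹ ∈ S}`. -/
noncomputable def supportedOn (S : Set G) : Submodule ℂ (reducedCStarAlgebra G) where
  carrier := {a | ∀ x z : G, ¬ (src x = src z ∧ x * z⁻¹ ∈ S) →
    matrixEntry x z (a : L2 G →L[ℂ] L2 G) = 0}
  zero_mem' x z _ := map_zero (matrixEntry x z)
  add_mem' {a b} ha hb x z h :=
    (map_add (matrixEntry x z) (a : L2 G →L[ℂ] L2 G) b).trans (by rw [ha x z h, hb x z h, add_zero])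
  smul_mem' t a ha x z h :=
    (map_smul (matrixEntry x z) t (a : L2 G →L[ℂ] L2 G)).trans (by rw [ha x z h, smul_zero])

theorem isClosed_supportedOn (S : Set G) :
    IsClosed (supportedOn S : Set (reducedCStarAlgebra G)) := by
  have : (supportedOn S : Set (reducedCStarAlgebra G)) =
      ⋂ (x : G) (z : G) (_ : ¬ (src x = src z ∧ x * z⁻¹ ∈ S)),
        {a : reducedCStarAlgebra G | matrixEntry x z (a : L2 G →L[ℂ] L2 G) = 0} := by
    ext a
    simp only [Set.mem_iInter]
    rfl
  rw [this]
  exact isClosed_iInter fun x => isClosed_iInter fun z => isClosed_iInter fun _ =>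
    isClosed_eq ((continuous_matrixEntry x z).comp continuous_subtype_val) continuous_const

theorem reducedPiece_le_supportedOn (γ : Γ) : reducedPiece c γ ≤ supportedOn (c ⁻¹' {γ}) := by
  refine Submodule.topologicalClosure_minimal _ ?_ (isClosed_supportedOn _)
  rintro _ ⟨f, hf, rfl⟩ x z h
  rw [coe_steinbergToReduced, matrixEntry_regularRep]
  exact kernel_eq_zero hf h

theorem iSupIndep_reducedPiece : iSupIndep fun γ : Γ => reducedPiece c γ := by
  intro γ
  rw [Submodule.disjoint_def]
  intro a ha hb
  have h1 := reducedPiece_le_supportedOn γ ha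
  -- The sum of the other pieces has entries only off `c⁻¹(γ)`, whereas `a` has entries only on it.
  have hle : ⨆ β, ⨆ (_ : β ≠ γ), reducedPiece c β ≤ supportedOn (c ⁻¹' {γ})ᶜ :=
    iSup₂_le fun β hβ => (reducedPiece_le_supportedOn β).trans fun b hb x z h =>
      hb x z fun h' => h ⟨h'.1, fun h'' => hβ (h'.2.symm.trans h'')⟩
  have h2 := hle hb
  refine Subtype.ext (ext_matrixEntry fun x z => ?_)
  rw [ZeroMemClass.coe_zero, map_zero]
  by_cases h : src x = src z ∧ x * z⁻¹ ∈ c ⁻¹' {γ}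
  · exact h2 x z fun h' => h'.2 h.2
  · exact h1 x z h

variable [TopologicalSpace Γ] [DiscreteTopology Γ]

theorem indicator_preimage_mem [IsAmple G] (hc : Continuous c) (γ : Γ) {f : G → ℂ}
    (hf : f ∈ steinbergAlgebra G) : (c ⁻¹' {γ}).indicator f ∈ steinbergOn (c ⁻¹' {γ}) := by
  rw [← steinbergOn_univ] at hf
  have hcl : IsClopen (c ⁻¹' {γ}) := (isClopen_discrete {γ}).preimage hc
  exact indicator_mem_steinbergOn hf fun B _ hB hK => ⟨Set.inter_subset_right,
    hB.mono (hB.isOpen.inter hcl.isOpen) Set.inter_subset_left, hK.inter_right hcl.isClosed⟩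

/-- Turns the support condition into a spanning condition: restricting each bisection of an
expansion of `f` to `c⁻¹(γ)` leaves `f` unchanged when its support lies there. -/
theorem mem_map_steinbergPiece [IsAmple G] (hc : Continuous c) (γ : Γ)
    (a : reducedCStarAlgebra G) : a ∈ (steinbergPiece c γ).map (steinbergToReduced G) ↔
      (a : L2 G →L[ℂ] L2 G) ∈ operatorsOn (c ⁻¹' {γ}) := by
  constructor
  · rintro ⟨f, hf, rfl⟩
    rw [coe_steinbergToReduced]
    refine regularRep_mem_operatorsOn ?_ _
    rw [← Set.indicator_eq_self.2 hf]
    exact indicator_preimage_mem hc γ f.2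
  · intro ha
    obtain ⟨f, hf, h, hfa⟩ := exists_regularRep_eq ha
    exact ⟨⟨f, steinbergOn_le _ hf⟩, support_subset_of_mem_steinbergOn hf, Subtype.ext hfa⟩

theorem iSup_steinbergPiece [IsAmple G] (hc : Continuous c) : ⨆ γ, steinbergPiece c γ = ⊤ := by
  have hle : steinbergAlgebra G ≤
      (⨆ γ, steinbergPiece c γ).map (steinbergAlgebra G).subtype := by
    refine Submodule.span_le.2 ?_
    rintro _ ⟨B, hB, hK, rfl⟩
    -- A compact subset of the discrete group is finite, so `1_B` splits into finitely many
    -- homogeneous parts.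
    have hfin : (c '' B).Finite := (hK.image hc).finite_of_discrete
    have hmem := indicator_mem_steinbergAlgebra hB hK
    have hsum : B.indicator (fun _ => (1 : ℂ)) =
        ∑ γ ∈ hfin.toFinset, (c ⁻¹' {γ}).indicator (B.indicator fun _ => 1) := by
      classical
      ext x
      rw [Finset.sum_apply]
      simp only [Set.indicator_apply, Set.mem_preimage, Set.mem_singleton_iff,
        Finset.sum_ite_eq, Set.Finite.mem_toFinset]
      by_cases hx : x ∈ B
      · simp [hx, Set.mem_image_of_mem c hx]
      · simp [hx]
    rw [SetLike.mem_coe, hsum]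
    refine sum_mem fun γ _ => ?_
    exact ⟨⟨_, steinbergOn_le _ (indicator_preimage_mem hc γ hmem)⟩,
      Submodule.mem_iSup_of_mem γ Set.support_indicator_subset, rfl⟩
  refine top_unique fun f _ => ?_
  obtain ⟨g, hg, hgf⟩ := hle f.2
  rwa [← Subtype.ext hgf]

theorem mul_mem_reducedPiece [IsAmple G] [T2Space (UnitSpace G)] [Group Γ] (hc : Continuous c)
    (hcocycle : IsCocycle c) {α β : Γ} {a b : reducedCStarAlgebra G} (ha : a ∈ reducedPiece c α)
    (hb : b ∈ reducedPiece c β) : a * b ∈ reducedPiece c (α * β) := by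
  refine map_mem_closure₂ (f := fun a b : reducedCStarAlgebra G => a * b) continuous_mul ha hb ?_
  intro a ha b hb
  replace ha := (mem_map_steinbergPiece hc _ a).1 ha
  replace hb := (mem_map_steinbergPiece hc _ b).1 hb
  refine (mem_map_steinbergPiece hc _ _).2 ?_
  refine mul_mem_operatorsOn (fun x hx y hy h => ?_) ha hb
  rw [Set.mem_preimage, Set.mem_singleton_iff] at hx hy ⊢
  rw [hcocycle x y h, hx, hy]

theorem star_mem_reducedPiece [IsAmple G] [Group Γ] (hc : Continuous c)
    (hcocycle : IsCocycle c) {γ : Γ} {a : reducedCStarAlgebra G} (ha : a ∈ reducedPiece c γ) :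
    star a ∈ reducedPiece c γ⁻¹ := by
  refine map_mem_closure (f := fun a : reducedCStarAlgebra G => star a) continuous_star ha ?_
  intro a ha
  replace ha := (mem_map_steinbergPiece hc _ a).1 ha
  refine (mem_map_steinbergPiece hc _ _).2 ?_
  refine star_mem_operatorsOn (fun x hx => ?_) ha
  rw [Set.mem_preimage, Set.mem_singleton_iff, hcocycle.map_inv] at hx
  rw [Set.mem_preimage, Set.mem_singleton_iff, ← hx, inv_inv]

theorem dense_iSup_reducedPiece [IsAmple G] [T2Space (UnitSpace G)] (hc : Continuous c) :
    Dense ((⨆ γ, reducedPiece c γ : Submodule ℂ (reducedCStarAlgebra G)) :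
      Set (reducedCStarAlgebra G)) := by
  have hle : LinearMap.range (steinbergToReduced G) ≤ ⨆ γ, reducedPiece c γ := by
    rw [← Submodule.map_top, ← iSup_steinbergPiece hc, Submodule.map_iSup]
    exact iSup_mono fun γ => Submodule.le_topologicalClosure _
  intro a
  -- Closure in `C*_r(G)` is the trace of the closure among all operators, where
  -- `reducedCStarAlgebra_le` applies.
  rw [Topology.IsInducing.subtypeVal.closure_eq_preimage_closure_image]
  refine closure_mono ?_ (reducedCStarAlgebra_le a.2)
  intro T hT
  obtain ⟨f, hf, h, hfT⟩ := exists_regularRep_eq (show T ∈ operatorsOn Set.univ from hT)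
  exact ⟨steinbergToReduced G ⟨f, steinbergOn_le _ hf⟩, hle ⟨_, rfl⟩, hfT⟩

end Grading

end TopologicalGroupoid

theorem mainTheorem4 {G : Type*} [TopologicalSpace G] [TopologicalGroupoid G]
    [TopologicalGroupoid.IsAmple G] [T2Space (TopologicalGroupoid.UnitSpace G)]
    {Γ : Type*} [Group Γ] [TopologicalSpace Γ] [DiscreteTopology Γ]
    (c : G → Γ) (hc : Continuous c) (hcocycle : TopologicalGroupoid.IsCocycle c) :
    IsGradedCStarAlgebra (fun γ : Γ => TopologicalGroupoid.reducedPiece c γ) where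
  isClosed _ := Submodule.isClosed_topologicalClosure _
  independent := TopologicalGroupoid.iSupIndep_reducedPiece
  mul_mem _ _ _ ha _ hb := TopologicalGroupoid.mul_mem_reducedPiece hc hcocycle ha hb
  star_mem _ _ ha := TopologicalGroupoid.star_mem_reducedPiece hc hcocycle ha
  dense := TopologicalGroupoid.dense_iSup_reducedPiece hc
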